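/- For a Dirichlet series $f(s)=\sum_{n\ge 1} a_n n^{-s}$ with complex coefficients let $\sigma_c(f)\in[-\infty,\infty]$ be its abscissa of convergence, that is, the infimum of all $r\in\mathbb{R}$ such that the series converges at every $s$ with $\operatorname{Re} s>r$. Let $\mathcal{H}^\infty_+$ be the space of all analytic functions $f$ on $\{\operatorname{Re} s>0\}$ which are bounded on $\{\operatorname{Re} s>\varepsilon\}$ for each $\varepsilon>0$ and which can be represented as a Dirichlet series convergent in $\{\operatorname{Re} s>0\}$ (such functions are identified with their Dirichlet series), endowed with the locally convex topology defined by the seminorms $P_\varepsilon(f)=\sup_{\operatorname{Re} s>\varepsilon}|f(s)|$, $\varepsilon>0$. For a Dirichlet series $g(s)=\sum_{n\ge1} a_n n^{-s}$ put $g'(s)=-\sum_{n\ge 2} a_n(\log n)\,n^{-s}$, and for a Dirichlet series $h(s)=\sum_{n\ge 2} b_n n^{-s}$ with vanishing first coefficient put $J(h)(s)=-\sum_{n\ge 2}\frac{b_n}{\log n}\,n^{-s}$. The Volterra operator with symbol $g$ is the linear map $V_g(f)=J(g'f)$, where $g'f$ is the product of Dirichlet series (Dirichlet convolution of the coefficients),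 whose first coefficient is $0$. Let $g$ be a Dirichlet series with $\sigma_c(g)\le 0$. Then $V_g$ maps $\mathcal{H}^\infty_+$ into itself if and only if $g\in\mathcal{H}^\infty_+$. Moreover, if $V_g$ maps $\mathcal{H}^\infty_+$ into itself, then $V_g:\mathcal{H}^\infty_+\to\mathcal{H}^\infty_+$ is continuous. -/

import Mathlib

open Filter Topology

noncomputable section

namespace DirichletSpace

/-- The open half-plane of all `s` with `r < Re s`. -/
def halfPlane (r : ℝ) : Set ℂ := {s | r < s.re}

/-- The partial sum `∑_{n=1}^N a_n n^{-s}` of the Dirichlet series with coefficients `a`.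
A Dirichlet series is given by its coefficients `a_1, a_2, …`, that is, by an
`ArithmeticFunction ℂ`; the ring product there is the product of Dirichlet series. -/
def partialSum (a : ArithmeticFunction ℂ) (s : ℂ) (N : ℕ) : ℂ :=
  ∑ n ∈ Finset.Icc 1 N, a n * (n : ℂ) ^ (-s)

/-- (Possibly conditional) convergence of the Dirichlet series at the point `s`. -/
def ConvergesAt (a : ArithmeticFunction ℂ) (s : ℂ) : Prop :=
  ∃ l : ℂ, Tendsto (partialSum a s) atTop (𝓝 l)

/-- The sum of the Dirichlet series at a point where it converges. -/
def value (a : ArithmeticFunction ℂ) (s : ℂ) : ℂ := limUnder atTop (partialSum a s)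

/-- The abscissa of convergence `σ_c`; it is `⊤` if the series converges on no half-plane. -/
def abscissaOfConv (a : ArithmeticFunction ℂ) : EReal :=
  sInf ((fun r : ℝ => (r : EReal)) '' {r : ℝ | ∀ s ∈ halfPlane r, ConvergesAt a s})

lemma ConvergesAt.tendsto {a : ArithmeticFunction ℂ} {s : ℂ} (h : ConvergesAt a s) :
    Tendsto (partialSum a s) atTop (𝓝 (value a s)) :=
  tendsto_nhds_limUnder h

lemma tendsto_add {a b : ArithmeticFunction ℂ} {s : ℂ} (ha : ConvergesAt a s)
    (hb : ConvergesAt b s) :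
    Tendsto (partialSum (a + b) s) atTop (𝓝 (value a s + value b s)) := by
  refine (ha.tendsto.add hb.tendsto).congr fun N => ?_
  simp [partialSum, add_mul, Finset.sum_add_distrib]

lemma tendsto_smul {a : ArithmeticFunction ℂ} {s : ℂ} (c : ℂ) (ha : ConvergesAt a s) :
    Tendsto (partialSum (c • a) s) atTop (𝓝 (c * value a s)) := by
  refine (ha.tendsto.const_mul c).congr fun N => ?_
  simp [partialSum, Finset.mul_sum, mul_assoc]

lemma value_add {a b : ArithmeticFunction ℂ} {s : ℂ} (ha : ConvergesAt a s)
    (hb : ConvergesAt b s) : value (a + b) s = value a s + value b s :=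
  (tendsto_add ha hb).limUnder_eq

lemma value_smul {a : ArithmeticFunction ℂ} {s : ℂ} (c : ℂ) (ha : ConvergesAt a s) :
    value (c • a) s = c * value a s :=
  (tendsto_smul c ha).limUnder_eq

lemma tendsto_zero (s : ℂ) : Tendsto (partialSum 0 s) atTop (𝓝 0) := by
  have h : partialSum 0 s = fun _ => 0 := by
    funext N
    simp [partialSum]
  rw [h]
  exact tendsto_const_nhds

lemma value_zero (s : ℂ) : value 0 s = 0 := (tendsto_zero s).limUnder_eq

/-- The space of Dirichlet series that converge in the half-plane `Re s > 0` to an analytic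
function which is bounded on `Re s > ε` for each `ε > 0`. -/
def HInfPlus : Submodule ℂ (ArithmeticFunction ℂ) where
  carrier := {a | (∀ s ∈ halfPlane 0, ConvergesAt a s) ∧
    DifferentiableOn ℂ (value a) (halfPlane 0) ∧
    ∀ ε : ℝ, 0 < ε → ∃ C : ℝ, ∀ s ∈ halfPlane ε, ‖value a s‖ ≤ C}
  zero_mem' := by
    refine ⟨fun s _ => ⟨0, tendsto_zero s⟩, ?_, fun ε _ => ⟨0, fun s _ => by simp [value_zero]⟩⟩
    exact (differentiableOn_const 0).congr fun s _ => value_zero s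
  add_mem' := by
    rintro a b ⟨ha, ha', ha''⟩ ⟨hb, hb', hb''⟩
    refine ⟨fun s hs => ⟨_, tendsto_add (ha s hs) (hb s hs)⟩, ?_, fun ε hε => ?_⟩
    · exact (ha'.add hb').congr fun s hs => value_add (ha s hs) (hb s hs)
    · obtain ⟨C, hC⟩ := ha'' ε hε
      obtain ⟨C', hC'⟩ := hb'' ε hε
      refine ⟨C + C', fun s hs => ?_⟩
      have hs0 : s ∈ halfPlane 0 := lt_trans hε hs
      rw [value_add (ha s hs0) (hb s hs0)]
      exact (norm_add_le _ _).trans (add_le_add (hC s hs) (hC' s hs))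
  smul_mem' := by
    rintro c a ⟨ha, ha', ha''⟩
    refine ⟨fun s hs => ⟨_, tendsto_smul c (ha s hs)⟩, ?_, fun ε hε => ?_⟩
    · exact (ha'.const_mul c).congr fun s hs => value_smul c (ha s hs)
    · obtain ⟨C, hC⟩ := ha'' ε hε
      refine ⟨‖c‖ * C, fun s hs => ?_⟩
      have hs0 : s ∈ halfPlane 0 := lt_trans hε hs
      rw [value_smul c (ha s hs0), norm_mul]
      exact mul_le_mul_of_nonneg_left (hC s hs) (norm_nonneg c)

lemma HInfPlus.bddAbove (f : HInfPlus) {ε : ℝ} (hε : 0 < ε) :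
    BddAbove (Set.range fun s : halfPlane ε => ‖value f.1 s‖) := by
  obtain ⟨C, hC⟩ := f.2.2.2 ε hε
  exact ⟨C, by rintro _ ⟨s, rfl⟩; exact hC s s.2⟩

lemma HInfPlus.convergesAt (f : HInfPlus) {ε : ℝ} (hε : 0 < ε) (s : halfPlane ε) :
    ConvergesAt f.1 s :=
  f.2.1 s (lt_trans hε s.2)

lemma halfPlane_nonempty (r : ℝ) : Nonempty (halfPlane r) :=
  ⟨⟨((r + 1 : ℝ) : ℂ), by simp [halfPlane]⟩⟩

/-- The seminorms `P_ε f = sup {|f s| : Re s > ε}`, `ε > 0`. -/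
def supSeminorm : SeminormFamily ℂ HInfPlus {ε : ℝ // 0 < ε} := fun ε =>
  Seminorm.of (fun f => ⨆ s : halfPlane ε, ‖value f.1 s‖)
    (by
      intro f g
      have := halfPlane_nonempty ε
      refine ciSup_le fun s => ?_
      change ‖value (f.1 + g.1) s‖ ≤ _
      rw [value_add (HInfPlus.convergesAt f ε.2 s) (HInfPlus.convergesAt g ε.2 s)]
      exact (norm_add_le _ _).trans
        (add_le_add (le_ciSup (HInfPlus.bddAbove f ε.2) s) (le_ciSup (HInfPlus.bddAbove g ε.2) s)))
    (by
      intro c f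
      rw [Real.mul_iSup_of_nonneg (norm_nonneg c)]
      refine iSup_congr fun s => ?_
      change ‖value (c • f.1) s‖ = _
      rw [value_smul c (HInfPlus.convergesAt f ε.2 s), norm_mul])

/-- The locally convex topology defined by the seminorms `P_ε`, `ε > 0`. -/
instance : TopologicalSpace HInfPlus := supSeminorm.moduleFilterBasis.topology

/-- Term by term differentiation: `∑ a_n n^{-s}` becomes `-∑ a_n (log n) n^{-s}`. -/
def D : ArithmeticFunction ℂ →ₗ[ℂ] ArithmeticFunction ℂ where
  toFun a := ⟨fun n => -(a n * (Real.log n : ℂ)), by simp⟩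
  map_add' a b := by
    ext n
    change -((a n + b n) * (Real.log n : ℂ)) = -(a n * _) + -(b n * _)
    ring
  map_smul' c a := by
    ext n
    change -((c * a n) * (Real.log n : ℂ)) = c * -(a n * _)
    ring

/-- Term by term integration: `∑_{n≥2} a_n n^{-s}` becomes `-∑_{n≥2} (a_n / log n) n^{-s}`.
It is only meant for series with `a_1 = 0`; in general the term `a_1` is dropped. -/
def J : ArithmeticFunction ℂ →ₗ[ℂ] ArithmeticFunction ℂ where
  toFun a := ⟨fun n => if 2 ≤ n then -(a n / (Real.log n : ℂ)) else 0, by simp⟩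
  map_add' a b := by
    ext n
    change (if 2 ≤ n then -((a n + b n) / (Real.log n : ℂ)) else 0) =
      (if 2 ≤ n then -(a n / (Real.log n : ℂ)) else 0) +
      (if 2 ≤ n then -(b n / (Real.log n : ℂ)) else 0)
    split_ifs <;> ring
  map_smul' c a := by
    ext n
    change (if 2 ≤ n then -((c * a n) / (Real.log n : ℂ)) else 0) =
      c * (if 2 ≤ n then -(a n / (Real.log n : ℂ)) else 0)
    split_ifs <;> ring

/-- The first coefficient of `g' f` vanishes, so that `J` applies to it. -/
lemma D_mul_apply_one (g f : ArithmeticFunction ℂ) : (D g * f) 1 = 0 := by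
  have h : D g 1 = 0 := by
    change -(g 1 * ((Real.log (1 : ℕ) : ℝ) : ℂ)) = 0
    simp
  simp [h]

/-- The Volterra operator `V_g f = J (g' f)`, on Dirichlet series. -/
def volterra (g : ArithmeticFunction ℂ) : ArithmeticFunction ℂ →ₗ[ℂ] ArithmeticFunction ℂ where
  toFun f := J (D g * f)
  map_add' f₁ f₂ := by rw [mul_add, map_add]
  map_smul' c f := by
    have h : D g * (c • f) = c • (D g * f) := by
      ext n
      simp [Finset.mul_sum]
    rw [h, map_smul, RingHom.id_apply]

end DirichletSpace

end

/-! Testing on `f = 1` recovers `g` up to its constant term (`volterra_one`), so invariance forces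
`g` into the space.

The converse and continuity rest on a quantitative Bohr theorem (`exists_norm_partialSum_le`): if a
Dirichlet series converges absolutely in some half-plane to a function that extends analytically to
`Re s > ε` with bound `M`, its partial sums on `Re s > ε + δ` are at most `L * M`, where `L` depends
only on `δ`. To prove this, the `N`-th partial sum is written as a vertical convolution of the
function with a kernel whose Fourier transform is a trapezoid, equal to 1 up to `log N` and 0 from
`log (N + 1)` on. The `L¹` norm of that kernel is `O(N ^ θ)` for each small `θ > 0`, and partial
summation removes the factor `N ^ θ` at the cost of the shift `δ`.

Bohr's theorem applies to the product `g' f`, whose sum is bounded by the product of the suprema.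
Passing from `g' f` to `J (g' f)` multiplies the coefficients, up to sign, by the decreasing weights
`1 / log n`, so bounded partial sums stay bounded (`norm_partialSum_J_le`). Bounded partial sums on
every `Re s > ε` give membership (`mem_HInfPlus_of_bounded`), and the uniformity of `L` gives
continuity. -/

noncomputable section

namespace DirichletSpace

open MeasureTheory FourierTransform

/-! ### Fourier transforms of triangles and trapezoids -/

/-- The triangle function `x ↦ max 0 (A - |x|)`. -/
def triangle (A x : ℝ) : ℝ := max 0 (A - |x|)

lemma continuous_triangle (A : ℝ) : Continuous (triangle A) := by
  unfold triangle; fun_prop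

lemma support_triangle_subset (A : ℝ) :
    Function.support (fun x => (triangle A x : ℂ)) ⊆ Set.Ioc (-A) A := by
  intro x hx
  by_contra h
  apply hx
  have : A ≤ |x| := by
    by_contra! h'
    rw [abs_lt] at h'
    exact h ⟨h'.1, h'.2.le⟩
  simp [triangle, max_eq_left (sub_nonpos.2 this)]

lemma integrable_triangle (A : ℝ) : Integrable (fun x => (triangle A x : ℂ)) := by
  refine Continuous.integrable_of_hasCompactSupport ?_ ?_
  · exact Complex.continuous_ofReal.comp (continuous_triangle A)
  · exact HasCompactSupport.of_support_subset_isCompact isCompact_Icc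
      ((support_triangle_subset A).trans Set.Ioc_subset_Icc_self)

/-- Covers both sides of the triangle, with slope parameter `σ = -1` on the left and `σ = 1` on the
right. -/
lemma integral_affine_mul_exp {c : ℂ} (hc : c ≠ 0) (A σ p q : ℝ) :
    ∫ x in p..q, Complex.exp (c * x) * (A - σ * x : ℝ) =
      (((A - σ * q) / c + σ / c ^ 2) * Complex.exp (c * q)) -
      (((A - σ * p) / c + σ / c ^ 2) * Complex.exp (c * p)) := by
  have hder : ∀ x ∈ Set.uIcc p q, HasDerivAt
      (fun x : ℝ => (((A - σ * x) / c + σ / c ^ 2) * Complex.exp (c * x) : ℂ))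
      (Complex.exp (c * x) * (A - σ * x : ℝ)) x := by
    intro x _
    have h1 : HasDerivAt (fun x : ℝ => Complex.exp (c * x)) (Complex.exp (c * x) * c) x := by
      simpa using ((Complex.ofRealCLM.hasDerivAt (x := x)).const_mul c).cexp
    have h2 : HasDerivAt (fun x : ℝ => ((A - σ * x) / c + σ / c ^ 2 : ℂ)) (-σ / c) x := by
      simpa using ((((Complex.ofRealCLM.hasDerivAt (x := x)).const_mul (σ : ℂ)).const_sub
        (A : ℂ)).div_const c).add_const ((σ : ℂ) / c ^ 2)
    refine (h2.mul h1).congr_deriv ?_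
    push_cast
    field_simp
    ring
  exact intervalIntegral.integral_eq_sub_of_hasDerivAt hder
    (Continuous.intervalIntegrable (by fun_prop) _ _)

/-- The point `t = 0` is left out because division by zero makes the formula 0 there, whereas the
transform is `A ^ 2`. A null set does no harm later. -/
lemma fourier_triangle {A t : ℝ} (hA : 0 ≤ A) (ht : t ≠ 0) :
    𝓕 (fun x => (triangle A x : ℂ)) t =
      ((Real.sin (Real.pi * A * t) ^ 2 / (Real.pi * t) ^ 2 : ℝ) : ℂ) := by
  rw [Real.fourier_real_eq_integral_exp_smul]
  set c : ℂ := -2 * Real.pi * t * Complex.I with hc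
  have hc0 : c ≠ 0 := by
    simp [hc, ht, Real.pi_ne_zero]
  have h1 : ∀ x : ℝ, Complex.exp (↑(-2 * Real.pi * x * t) * Complex.I) • (triangle A x : ℂ) =
      Complex.exp (c * x) * (triangle A x : ℂ) := by
    intro x
    rw [smul_eq_mul, hc]
    congr 2
    push_cast
    ring
  simp_rw [h1]
  have hcont : Continuous fun x : ℝ => Complex.exp (c * x) * (triangle A x : ℂ) := by
    have := continuous_triangle A
    fun_prop
  have hsupp : (Function.support fun x : ℝ => Complex.exp (c * x) * (triangle A x : ℂ)) ⊆
      Set.Ioc (-A) A := by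
    refine subset_trans ?_ (support_triangle_subset A)
    intro x hx hx'
    exact hx (by simp only [hx', mul_zero])
  rw [← intervalIntegral.integral_eq_integral_of_support_subset hsupp,
    ← intervalIntegral.integral_add_adjacent_intervals (b := 0)
      (hcont.intervalIntegrable _ _) (hcont.intervalIntegrable _ _)]
  have hneg : ∫ x in (-A)..0, Complex.exp (c * x) * (triangle A x : ℂ) =
      ∫ x in (-A)..0, Complex.exp (c * x) * (A - (-1 : ℝ) * x : ℝ) := by
    refine intervalIntegral.integral_congr fun x hx => ?_
    rw [Set.uIcc_of_le (by linarith)] at hx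
    have : triangle A x = A - (-1) * x := by
      rw [triangle, abs_of_nonpos hx.2, max_eq_right (by linarith [hx.1])]
      ring
    simp only [this]
  have hpos : ∫ x in 0..A, Complex.exp (c * x) * (triangle A x : ℂ) =
      ∫ x in 0..A, Complex.exp (c * x) * (A - (1 : ℝ) * x : ℝ) := by
    refine intervalIntegral.integral_congr fun x hx => ?_
    rw [Set.uIcc_of_le hA] at hx
    have : triangle A x = A - 1 * x := by
      rw [triangle, abs_of_nonneg hx.1, max_eq_right (by linarith [hx.2])]
      ring
    simp only [this]
  rw [hneg, hpos, integral_affine_mul_exp hc0 A (-1),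
    integral_affine_mul_exp hc0 A 1]
  have hsum : Complex.exp (c * A) + Complex.exp (-(c * A)) =
      2 - 4 * Complex.sin (Real.pi * A * t) ^ 2 := by
    have h2 := Complex.two_cos (2 * (Real.pi * A * t : ℂ))
    have e1 : c * A = -(2 * (Real.pi * A * t : ℂ)) * Complex.I := by rw [hc]; ring
    have e2 : -(c * A) = 2 * (Real.pi * A * t : ℂ) * Complex.I := by rw [hc]; ring
    rw [e2, e1, add_comm, ← h2, Complex.cos_two_mul, Complex.cos_sq']
    ring
  have hc2 : c ^ 2 = -4 * (Real.pi * t : ℂ) ^ 2 := by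
    rw [hc]
    ring_nf
    simp
  have hpt : (Real.pi * t : ℂ) ≠ 0 := by
    simp [ht, Real.pi_ne_zero]
  have hgoal : (Complex.exp (c * A) + Complex.exp (-(c * A)) - 2) / c ^ 2 =
      Complex.sin (Real.pi * A * t) ^ 2 / (Real.pi * t : ℂ) ^ 2 := by
    rw [hsum, hc2]
    field_simp
    ring
  push_cast
  rw [← hgoal]
  have e0 : c * -(A : ℂ) = -(c * A) := by ring
  rw [e0]
  simp only [mul_zero, Complex.exp_zero]
  field_simp
  ring

/-- The trapezoid function with value `1` on `[-B, B]` and `0` outside `[-A, A]`. -/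
def trapezoid (A B x : ℝ) : ℝ := (triangle A x - triangle B x) / (A - B)

lemma trapezoid_eq_one {A B x : ℝ} (hAB : B < A) (hx : |x| ≤ B) : trapezoid A B x = 1 := by
  rw [trapezoid, triangle, triangle, max_eq_right (by linarith), max_eq_right (by linarith),
    div_eq_one_iff_eq (by linarith)]
  ring

lemma trapezoid_eq_zero {A B x : ℝ} (hAB : B < A) (hx : A ≤ |x|) : trapezoid A B x = 0 := by
  rw [trapezoid, triangle, triangle, max_eq_left (by linarith), max_eq_left (by linarith)]
  simp

/-- The Fourier transform of the trapezoid function. -/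
def trapezoidKernel (A B t : ℝ) : ℝ :=
  Real.sin (Real.pi * (A + B) * t) * Real.sin (Real.pi * (A - B) * t) /
    ((A - B) * (Real.pi * t) ^ 2)

/-- The difference of two triangle transforms factors through `sin² α - sin² β = sin (α + β) sin (α
- β)`. The product form is what makes good `L¹` bounds possible. -/
lemma fourier_trapezoid {A B t : ℝ} (hB : 0 ≤ B) (hAB : B < A) (ht : t ≠ 0) :
    𝓕 (fun x => (trapezoid A B x : ℂ)) t = (trapezoidKernel A B t : ℂ) := by
  have h0 : (fun x => (trapezoid A B x : ℂ)) =
      fun x => ((A - B : ℝ) : ℂ)⁻¹ * ((triangle A x : ℂ) - (triangle B x : ℂ)) := by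
    funext x
    rw [trapezoid]
    push_cast
    rw [div_eq_inv_mul]
  have h1 : 𝓕 (fun x => (trapezoid A B x : ℂ)) t = ((A - B : ℝ) : ℂ)⁻¹ *
      (𝓕 (fun x => (triangle A x : ℂ)) t - 𝓕 (fun x => (triangle B x : ℂ)) t) := by
    rw [h0, Real.fourier_real_eq, Real.fourier_real_eq, Real.fourier_real_eq, ← integral_sub,
      ← integral_const_mul]
    · congr 1
      funext x
      simp only [Circle.smul_def, smul_eq_mul]
      ring
    · simpa [mul_comm] using (Real.fourierIntegral_convergent_iff t).2 (integrable_triangle A)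
    · simpa [mul_comm] using (Real.fourierIntegral_convergent_iff t).2 (integrable_triangle B)
  rw [h1, fourier_triangle (hB.trans hAB.le) ht, fourier_triangle hB ht, trapezoidKernel]
  have hs : Real.sin (Real.pi * (A + B) * t) * Real.sin (Real.pi * (A - B) * t) =
      Real.sin (Real.pi * A * t) ^ 2 - Real.sin (Real.pi * B * t) ^ 2 := by
    rw [show Real.pi * (A + B) * t = Real.pi * A * t + Real.pi * B * t by ring,
      show Real.pi * (A - B) * t = Real.pi * A * t - Real.pi * B * t by ring,
      Real.sin_add, Real.sin_sub]
    have ha := Real.sin_sq_add_cos_sq (Real.pi * A * t)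
    have hb := Real.sin_sq_add_cos_sq (Real.pi * B * t)
    linear_combination (-Real.sin (Real.pi * B * t) ^ 2) * ha +
      Real.sin (Real.pi * A * t) ^ 2 * hb
  rw [hs]
  have hAB' : A - B ≠ 0 := by linarith
  rw [← Complex.ofReal_inv, ← Complex.ofReal_sub, ← Complex.ofReal_mul]
  congr 1
  have : Real.pi * t ≠ 0 := mul_ne_zero Real.pi_ne_zero ht
  field_simp

/-! ### `L¹` bounds for the trapezoid kernel -/

lemma integrable_min_rpow {θ : ℝ} (hθ : 0 < θ) :
    Integrable fun t : ℝ => min (|t| ^ (θ - 1)) (|t| ^ (-1 - θ)) := by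
  set ψ : ℝ → ℝ := fun t => min (|t| ^ (θ - 1)) (|t| ^ (-1 - θ)) with hψ
  have hmeas : Measurable ψ := by
    rw [hψ]
    fun_prop
  have hnn : ∀ t, 0 ≤ ψ t := fun t =>
    le_min (Real.rpow_nonneg (abs_nonneg t) _) (Real.rpow_nonneg (abs_nonneg t) _)
  have h1 : IntegrableOn ψ (Set.Ioc 0 1) := by
    have h := (intervalIntegral.intervalIntegrable_rpow' (a := 0) (b := 1)
      (show -1 < θ - 1 by linarith)).1
    refine Integrable.mono' h hmeas.aestronglyMeasurable ?_
    refine (ae_restrict_iff' measurableSet_Ioc).2 (Eventually.of_forall fun t ht => ?_)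
    rw [Real.norm_of_nonneg (hnn t)]
    exact (min_le_left _ _).trans (by rw [abs_of_pos ht.1])
  have h2 : IntegrableOn ψ (Set.Ioi 1) := by
    have h := integrableOn_Ioi_rpow_of_lt (show -1 - θ < -1 by linarith) one_pos
    refine Integrable.mono' h hmeas.aestronglyMeasurable ?_
    refine (ae_restrict_iff' measurableSet_Ioi).2 (Eventually.of_forall fun t ht => ?_)
    rw [Real.norm_of_nonneg (hnn t)]
    exact (min_le_right _ _).trans (by rw [abs_of_pos (one_pos.trans ht)])
  have h3 : IntegrableOn ψ (Set.Ioi 0) := by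
    rw [← Set.Ioc_union_Ioi_eq_Ioi zero_le_one]
    exact h1.union h2
  have h4 : IntegrableOn ψ (Set.Iic 0) := by
    have h := h3.integrable_indicator measurableSet_Ioi |>.comp_neg
    rw [integrableOn_Iic_iff_integrableOn_Iio, ← integrable_indicator_iff measurableSet_Iio]
    refine h.congr (Eventually.of_forall fun t => ?_)
    by_cases ht : t < 0 <;> simp [Set.indicator, ht, hψ]
  rw [← integrableOn_univ, ← Set.Iic_union_Ioi (a := (0 : ℝ))]
  exact h4.union h3

/-- Interpolates between `|sin x| ≤ 1` and `|sin x| ≤ |x|`. -/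
lemma abs_sin_le_rpow {x α : ℝ} (h0 : 0 ≤ α) (h1 : α ≤ 1) : |Real.sin x| ≤ |x| ^ α := by
  rcases le_total |x| 1 with h | h
  · rcases eq_or_ne x 0 with rfl | hx
    · simpa using Real.rpow_nonneg le_rfl α
    · refine Real.abs_sin_le_abs.trans ?_
      simpa using Real.rpow_le_rpow_of_exponent_ge (abs_pos.2 hx) h h1
  · exact (Real.abs_sin_le_one x).trans (Real.one_le_rpow h h0)

/-- For the bound suited to small `t`, the two sines are estimated with exponents `θ` and `1`; for
the one suited to large `t`, with exponents `0` and `1 - θ`. Thus `A + B` and `(A - B)⁻¹` enter only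
to the power `θ`. -/
lemma abs_trapezoidKernel_le {A B θ t : ℝ} (hB : 0 ≤ B) (hAB : B < A) (h0 : 0 < θ) (h1 : θ ≤ 1)
    (ht : t ≠ 0) :
    |trapezoidKernel A B t| ≤
      ((Real.pi * (A + B)) ^ θ + (A - B) ^ (-θ)) * min (|t| ^ (θ - 1)) (|t| ^ (-1 - θ)) := by
  set P := A + B with hP
  set Q := A - B with hQ
  have hP0 : 0 < P := by linarith
  have hQ0 : 0 < Q := by linarith
  have hπ := Real.pi_pos
  have hπ1 : 1 ≤ Real.pi := by linarith [Real.pi_gt_three]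
  have hτ : 0 < |t| := abs_pos.2 ht
  have hK : |trapezoidKernel A B t| = |Real.sin (Real.pi * P * t)| * |Real.sin (Real.pi * Q * t)| /
      (Q * (Real.pi * |t|) ^ 2) := by
    rw [trapezoidKernel, abs_div, abs_mul, abs_mul, abs_of_pos hQ0, abs_pow, abs_mul,
      abs_of_pos hπ]
  have hden : 0 < Q * (Real.pi * |t|) ^ 2 := by positivity
  rw [hK, mul_min_of_nonneg _ _ (by positivity)]
  refine le_min ?_ ?_
  · have hs1 := abs_sin_le_rpow (x := Real.pi * P * t) h0.le h1
    have hs2 : |Real.sin (Real.pi * Q * t)| ≤ Real.pi * Q * |t| :=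
      Real.abs_sin_le_abs.trans (by rw [abs_mul, abs_of_pos (by positivity)])
    rw [abs_mul, abs_of_pos (show 0 < Real.pi * P by positivity),
      Real.mul_rpow (by positivity) hτ.le] at hs1
    calc _ ≤ ((Real.pi * P) ^ θ * |t| ^ θ) * (Real.pi * Q * |t|) / (Q * (Real.pi * |t|) ^ 2) := by
          gcongr
      _ = (Real.pi * P) ^ θ * |t| ^ (θ - 1) / Real.pi := by
          rw [Real.rpow_sub_one hτ.ne']
          field_simp
      _ ≤ (Real.pi * P) ^ θ * |t| ^ (θ - 1) := div_le_self (by positivity) hπ1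
      _ ≤ _ := by
          gcongr
          have : 0 ≤ Q ^ (-θ) := by positivity
          linarith
  · have hs1 := Real.abs_sin_le_one (Real.pi * P * t)
    have hs2 := abs_sin_le_rpow (x := Real.pi * Q * t) (sub_nonneg.2 h1) (by linarith)
    rw [abs_mul, abs_of_pos (show 0 < Real.pi * Q by positivity),
      Real.mul_rpow (by positivity) hτ.le, Real.mul_rpow hπ.le hQ0.le] at hs2
    have hπθ : Real.pi ^ (1 - θ) ≤ Real.pi ^ (2 : ℕ) := by
      rw [← Real.rpow_natCast]
      exact Real.rpow_le_rpow_of_exponent_le hπ1 (by push_cast; linarith)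
    calc _ ≤ 1 * (Real.pi ^ (2 : ℕ) * Q ^ (1 - θ) * |t| ^ (1 - θ)) /
            (Q * (Real.pi * |t|) ^ 2) := by
          gcongr
          exact hs2.trans (by gcongr)
      _ = Q ^ (-θ) * |t| ^ (-1 - θ) := by
          rw [show 1 - θ = -θ + 1 by ring, Real.rpow_add_one hQ0.ne',
            show (-1 - θ : ℝ) = -θ + 1 - 2 by ring, Real.rpow_sub hτ, Real.rpow_two]
          field_simp
      _ ≤ _ := by
          gcongr
          have : 0 ≤ (Real.pi * P) ^ θ := by positivity
          linarith

lemma measurable_trapezoidKernel (A B : ℝ) : Measurable (trapezoidKernel A B) := by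
  unfold trapezoidKernel
  fun_prop

lemma ae_ne_zero : ∀ᵐ t : ℝ, t ≠ 0 := by
  simp [ae_iff]

lemma integrable_trapezoidKernel {A B : ℝ} (hB : 0 ≤ B) (hAB : B < A) :
    Integrable (trapezoidKernel A B) := by
  refine Integrable.mono' ((integrable_min_rpow one_pos).const_mul
    ((Real.pi * (A + B)) ^ (1 : ℝ) + (A - B) ^ (-1 : ℝ)))
    (measurable_trapezoidKernel A B).aestronglyMeasurable ?_
  filter_upwards [ae_ne_zero] with t ht
  exact abs_trapezoidKernel_le hB hAB one_pos le_rfl ht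

lemma integral_abs_trapezoidKernel_le {A B θ : ℝ} (hB : 0 ≤ B) (hAB : B < A) (h0 : 0 < θ)
    (h1 : θ ≤ 1) :
    ∫ t, |trapezoidKernel A B t| ≤ ((Real.pi * (A + B)) ^ θ + (A - B) ^ (-θ)) *
      ∫ t : ℝ, min (|t| ^ (θ - 1)) (|t| ^ (-1 - θ)) := by
  rw [← integral_const_mul]
  refine integral_mono_ae (integrable_trapezoidKernel hB hAB).abs
    ((integrable_min_rpow h0).const_mul _) ?_
  filter_upwards [ae_ne_zero] with t ht
  exact abs_trapezoidKernel_le hB hAB h0 h1 ht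

/-! ### Fourier inversion and the cutoff between `log N` and `log (N + 1)` -/

/-- Fourier inversion for the trapezoid function. -/
lemma integral_trapezoidKernel {A B : ℝ} (hB : 0 ≤ B) (hAB : B < A) (x : ℝ) :
    ∫ t, (trapezoidKernel A B t : ℂ) * Complex.exp (2 * Real.pi * t * x * Complex.I) =
      trapezoid A B x := by
  have hae : 𝓕 (fun x => (trapezoid A B x : ℂ)) =ᵐ[volume]
      fun t => (trapezoidKernel A B t : ℂ) := by
    filter_upwards [ae_ne_zero] with t ht
    exact fourier_trapezoid hB hAB ht
  have hcont : Continuous fun x => (trapezoid A B x : ℂ) := by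
    have h1 := continuous_triangle A
    have h2 := continuous_triangle B
    unfold trapezoid
    fun_prop
  have hint : Integrable fun x => (trapezoid A B x : ℂ) := by
    have := ((integrable_triangle A).sub (integrable_triangle B)).div_const ((A - B : ℝ) : ℂ)
    refine this.congr (Eventually.of_forall fun x => ?_)
    simp [trapezoid]
  have hinv := congrFun (hcont.fourierInv_fourier_eq hint
    ((integrable_trapezoidKernel hB hAB).ofReal.congr hae.symm)) x
  rw [Real.fourierInv_eq'] at hinv
  rw [← hinv]
  refine integral_congr_ae ?_
  filter_upwards [hae] with t ht
  rw [ht, smul_eq_mul, mul_comm]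
  congr 2
  simp
  ring

/-- The kernel whose frequencies `log n` are cut off after `n = N`. -/
def cutoffKernel (N : ℕ) : ℝ → ℝ := trapezoidKernel (Real.log (N + 1)) (Real.log N)

lemma log_natCast_lt {N : ℕ} (hN : 1 ≤ N) : Real.log N < Real.log (N + 1) :=
  Real.log_lt_log (by exact_mod_cast hN) (by linarith)

lemma integrable_cutoffKernel {N : ℕ} (hN : 1 ≤ N) : Integrable (cutoffKernel N) :=
  integrable_trapezoidKernel (Real.log_natCast_nonneg N) (log_natCast_lt hN)

lemma integral_cutoffKernel {N : ℕ} (hN : 1 ≤ N) {n : ℕ} (hn : 1 ≤ n) :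
    ∫ t, (cutoffKernel N t : ℂ) * Complex.exp (2 * Real.pi * t * Real.log n * Complex.I) =
      if n ≤ N then 1 else 0 := by
  have h := integral_trapezoidKernel (Real.log_natCast_nonneg N) (log_natCast_lt hN) (Real.log n)
  rw [cutoffKernel, h]
  have hn0 : (0 : ℝ) < n := by exact_mod_cast hn
  have habs : |Real.log n| = Real.log n := abs_of_nonneg (Real.log_natCast_nonneg n)
  split_ifs with hle
  · rw [trapezoid_eq_one (log_natCast_lt hN)]
    · simp
    · rw [habs]
      exact Real.log_le_log hn0 (by exact_mod_cast hle)
  · rw [trapezoid_eq_zero (log_natCast_lt hN)]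
    · simp
    · rw [habs]
      refine Real.log_le_log (by positivity) ?_
      exact_mod_cast not_le.1 hle

/-- The `L¹` norms of the cutoff kernels grow more slowly than any power of `N`. -/
lemma exists_integral_abs_cutoffKernel_le {θ : ℝ} (h0 : 0 < θ) (h1 : θ ≤ 1) :
    ∃ C : ℝ, 0 ≤ C ∧ ∀ N : ℕ, 1 ≤ N → ∫ t, |cutoffKernel N t| ≤ C * (N : ℝ) ^ θ := by
  set I := ∫ t : ℝ, min (|t| ^ (θ - 1)) (|t| ^ (-1 - θ)) with hI
  have hI0 : 0 ≤ I := integral_nonneg fun t =>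
    le_min (Real.rpow_nonneg (abs_nonneg t) _) (Real.rpow_nonneg (abs_nonneg t) _)
  refine ⟨((Real.pi * 2) ^ θ + 2 ^ θ) * I, by positivity, fun N hN => ?_⟩
  have hN1 : (1 : ℝ) ≤ N := by exact_mod_cast hN
  have hN0 : (0 : ℝ) < N := by linarith
  have hP : Real.log (N + 1) + Real.log N ≤ 2 * N := by
    have h2 := Real.log_le_sub_one_of_pos hN0
    have h3 := Real.log_le_sub_one_of_pos (show (0 : ℝ) < N + 1 by linarith)
    linarith
  -- The gap is at least `1 / (N + 1)`, and `N + 1 ≤ 2 * N` because `N ≥ 1`.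
  have hQ : (2 * N : ℝ)⁻¹ ≤ Real.log (N + 1) - Real.log N := by
    rw [← Real.log_div (by positivity) hN0.ne']
    have h2 := Real.one_sub_inv_le_log_of_pos (show (0 : ℝ) < (N + 1) / N by positivity)
    refine le_trans ?_ h2
    rw [inv_div, inv_eq_one_div, div_le_iff₀ (by positivity)]
    have : (1 - N / (N + 1) : ℝ) * (2 * N) = 2 * N / (N + 1) := by field_simp; ring
    rw [this, le_div_iff₀ (by positivity)]
    linarith
  refine (integral_abs_trapezoidKernel_le (Real.log_natCast_nonneg N) (log_natCast_lt hN) h0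
    h1).trans ?_
  rw [← hI, mul_right_comm]
  refine mul_le_mul_of_nonneg_right ?_ hI0
  have hlog : 0 ≤ Real.log (N + 1) + Real.log N :=
    add_nonneg (Real.log_nonneg (by linarith)) (Real.log_natCast_nonneg N)
  rw [add_mul, ← Real.mul_rpow (by positivity) hN0.le, ← Real.mul_rpow (by positivity) hN0.le]
  refine add_le_add ?_ ?_
  · refine Real.rpow_le_rpow (by positivity) ?_ h0.le
    rw [mul_assoc]
    exact mul_le_mul_of_nonneg_left hP Real.pi_pos.le
  · rw [Real.rpow_neg (sub_nonneg.2 (log_natCast_lt hN).le), ← Real.inv_rpow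
      (sub_nonneg.2 (log_natCast_lt hN).le)]
    refine Real.rpow_le_rpow (inv_nonneg.2 (sub_nonneg.2 (log_natCast_lt hN).le)) ?_ h0.le
    exact inv_le_of_inv_le₀ (by positivity) hQ

/-! ### Analyticity and vertical convolution on half-planes -/

lemma isOpen_halfPlane (r : ℝ) : IsOpen (halfPlane r) :=
  isOpen_lt continuous_const Complex.continuous_re

lemma isPreconnected_halfPlane (r : ℝ) : IsPreconnected (halfPlane r) :=
  (convex_halfSpace_re_gt r).isPreconnected

lemma hasDerivAt_partialSum (a : ArithmeticFunction ℂ) (N : ℕ) (s : ℂ) :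
    HasDerivAt (fun s => partialSum a s N) (partialSum (D a) s N) s := by
  unfold partialSum
  refine HasDerivAt.fun_sum fun n hn => ?_
  have hn0 : (n : ℂ) ≠ 0 := by
    have := (Finset.mem_Icc.1 hn).1
    exact_mod_cast (by omega : n ≠ 0)
  refine ((((hasDerivAt_id s).neg).const_cpow (Or.inl hn0)).const_mul (a n)).congr_deriv ?_
  change _ = -(a n * (Real.log n : ℂ)) * _
  rw [Complex.natCast_log]
  simp
  ring

lemma differentiable_partialSum (a : ArithmeticFunction ℂ) (N : ℕ) :
    Differentiable ℂ fun s => partialSum a s N :=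
  fun s => (hasDerivAt_partialSum a N s).differentiableAt

/-- Cauchy's estimate on the circle of radius `r` about `s`, which stays inside the half-plane. -/
lemma norm_deriv_le_of_bounded {F : ℂ → ℂ} {ε M r : ℝ} (hF : DifferentiableOn ℂ F (halfPlane ε))
    (hM : ∀ s ∈ halfPlane ε, ‖F s‖ ≤ M) (hr : 0 < r) {s : ℂ} (hs : ε + r < s.re) :
    ‖deriv F s‖ ≤ M / r := by
  have hsub : Metric.closedBall s r ⊆ halfPlane ε := by
    intro z hz
    have h1 : |(z - s).re| ≤ r := (Complex.abs_re_le_norm _).trans (by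
      rwa [Metric.mem_closedBall, dist_eq_norm] at hz)
    rw [Complex.sub_re, abs_le] at h1
    change ε < z.re
    linarith [h1.1]
  refine Complex.norm_deriv_le_of_forall_mem_sphere_norm_le hr ?_
    fun z hz => hM z (hsub (Metric.sphere_subset_closedBall hz))
  refine DifferentiableOn.diffContOnCl (hF.mono ?_)
  exact Metric.closure_ball_subset_closedBall.trans hsub

section VerticalConvolution

variable {F : ℂ → ℂ} {ε M : ℝ} {k : ℝ → ℝ}

lemma sub_vertical_re (s : ℂ) (t : ℝ) : (s - 2 * Real.pi * t * Complex.I).re = s.re := by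
  simp

lemma continuous_comp_sub_vertical {G : ℂ → ℂ} (hG : ContinuousOn G (halfPlane ε)) {s : ℂ}
    (hs : s ∈ halfPlane ε) : Continuous fun t : ℝ => G (s - 2 * Real.pi * t * Complex.I) := by
  refine hG.comp_continuous (by fun_prop) fun t => ?_
  change ε < _
  rw [sub_vertical_re]
  exact hs

/-- Differentiation under the integral sign: vertical shifts preserve the real part, so Cauchy's
estimate bounds the derivative uniformly in `t`. -/
lemma differentiableOn_integral_vertical (hF : DifferentiableOn ℂ F (halfPlane ε))
    (hM : ∀ s ∈ halfPlane ε, ‖F s‖ ≤ M) (hk : Integrable k) :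
    DifferentiableOn ℂ (fun s => ∫ t, (k t : ℂ) * F (s - 2 * Real.pi * t * Complex.I))
      (halfPlane ε) := by
  intro s₀ hs₀
  set r : ℝ := (s₀.re - ε) / 2 with hr
  have hr0 : 0 < r := by
    have : ε < s₀.re := hs₀
    linarith
  have hball : ∀ x ∈ Metric.ball s₀ (r / 2), ε + r / 2 < x.re := by
    intro x hx
    have h1 : |(x - s₀).re| < r / 2 := (Complex.abs_re_le_norm _).trans_lt (by
      rwa [Metric.mem_ball, dist_eq_norm] at hx)
    rw [Complex.sub_re, abs_lt] at h1
    linarith [h1.1]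
  have hmem : ∀ x ∈ Metric.ball s₀ (r / 2), x ∈ halfPlane ε := fun x hx =>
    lt_trans (by linarith) (hball x hx)
  have hmeas : ∀ {G : ℂ → ℂ}, ContinuousOn G (halfPlane ε) → ∀ x ∈ halfPlane ε,
      AEStronglyMeasurable (fun t : ℝ => (k t : ℂ) * G (x - 2 * Real.pi * t * Complex.I)) :=
    fun hG x hx => hk.ofReal.aestronglyMeasurable.mul
      (continuous_comp_sub_vertical hG hx).aestronglyMeasurable
  have key := hasDerivAt_integral_of_dominated_loc_of_deriv_le (μ := volume) (x₀ := s₀)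
    (F := fun s t => (k t : ℂ) * F (s - 2 * Real.pi * t * Complex.I))
    (F' := fun s t => (k t : ℂ) * deriv F (s - 2 * Real.pi * t * Complex.I))
    (bound := fun t => |k t| * (M / (r / 2)))
    (Metric.ball_mem_nhds s₀ (half_pos hr0)) ?_ ?_ ?_ ?_ (hk.abs.mul_const _) ?_
  · exact key.2.differentiableAt.differentiableWithinAt
  · filter_upwards [Metric.ball_mem_nhds s₀ (half_pos hr0)] with x hx
    exact hmeas hF.continuousOn x (hmem x hx)
  · refine Integrable.mono' (hk.abs.mul_const M) (hmeas hF.continuousOn s₀ hs₀) ?_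
    refine Eventually.of_forall fun t => ?_
    rw [norm_mul, Complex.norm_real, Real.norm_eq_abs]
    refine mul_le_mul_of_nonneg_left (hM _ ?_) (abs_nonneg _)
    change ε < _
    rw [sub_vertical_re]
    exact hs₀
  · exact hmeas (hF.deriv (isOpen_halfPlane ε)).continuousOn s₀ hs₀
  · refine Eventually.of_forall fun t x hx => ?_
    rw [norm_mul, Complex.norm_real, Real.norm_eq_abs]
    refine mul_le_mul_of_nonneg_left (norm_deriv_le_of_bounded hF hM (half_pos hr0) ?_)
      (abs_nonneg _)
    rw [sub_vertical_re]
    exact hball x hx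
  · refine Eventually.of_forall fun t x hx => ?_
    have hx' : x - 2 * Real.pi * t * Complex.I ∈ halfPlane ε := by
      change ε < _
      rw [sub_vertical_re]
      exact hmem x hx
    have hd := ((hF _ hx').differentiableAt ((isOpen_halfPlane ε).mem_nhds hx')).hasDerivAt
    exact (HasDerivAt.comp_sub_const x _ hd).const_mul _

lemma norm_integral_vertical_le (hM : ∀ s ∈ halfPlane ε, ‖F s‖ ≤ M) (hk : Integrable k) {s : ℂ}
    (hs : s ∈ halfPlane ε) :
    ‖∫ t, (k t : ℂ) * F (s - 2 * Real.pi * t * Complex.I)‖ ≤ (∫ t, |k t|) * M := by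
  rw [← integral_mul_const]
  refine norm_integral_le_of_norm_le (hk.abs.mul_const M) (Eventually.of_forall fun t => ?_)
  rw [norm_mul, Complex.norm_real, Real.norm_eq_abs]
  refine mul_le_mul_of_nonneg_left (hM _ ?_) (abs_nonneg _)
  change ε < _
  rw [sub_vertical_re]
  exact hs

end VerticalConvolution

/-! ### Partial sums as convolutions -/

lemma term_sub_vertical (a : ArithmeticFunction ℂ) (s : ℂ) (t : ℝ) (n : ℕ) :
    LSeries.term a (s - 2 * Real.pi * t * Complex.I) n =
      LSeries.term a s n * Complex.exp (2 * Real.pi * t * Real.log n * Complex.I) := by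
  rcases eq_or_ne n 0 with rfl | hn
  · simp
  · have hn' : (n : ℂ) ≠ 0 := by exact_mod_cast hn
    rw [LSeries.term_of_ne_zero hn, LSeries.term_of_ne_zero hn, Complex.cpow_sub _ _ hn',
      Complex.natCast_log, Complex.cpow_def_of_ne_zero hn' (2 * Real.pi * t * Complex.I)]
    rw [show Complex.log n * (2 * Real.pi * t * Complex.I) =
      2 * Real.pi * t * Complex.log n * Complex.I by ring]
    field_simp

lemma partialSum_eq_sum_term (a : ArithmeticFunction ℂ) (s : ℂ) (N : ℕ) :
    partialSum a s N = ∑ n ∈ Finset.Icc 1 N, LSeries.term a s n := by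
  refine Finset.sum_congr rfl fun n hn => ?_
  have := (Finset.mem_Icc.1 hn).1
  rw [LSeries.term_of_ne_zero (by omega), Complex.cpow_neg, div_eq_mul_inv]

/-- Convolution with the cutoff kernel yields the partial sums of an absolutely convergent
Dirichlet series. -/
lemma integral_cutoffKernel_mul {a : ArithmeticFunction ℂ} {F : ℂ → ℂ} {σ : ℝ}
    (hsum : ∀ s ∈ halfPlane σ, LSeriesHasSum a s (F s)) {N : ℕ} (hN : 1 ≤ N) {s : ℂ}
    (hs : s ∈ halfPlane σ) :
    ∫ t, (cutoffKernel N t : ℂ) * F (s - 2 * Real.pi * t * Complex.I) = partialSum a s N := by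
  have hexp : ∀ (t : ℝ) (n : ℕ),
      ‖Complex.exp (2 * Real.pi * t * Real.log n * Complex.I)‖ = 1 := by
    intro t n
    rw [show (2 * Real.pi * t * Real.log n * Complex.I : ℂ) =
      ((2 * Real.pi * t * Real.log n : ℝ) : ℂ) * Complex.I by push_cast; ring]
    exact Complex.norm_exp_ofReal_mul_I _
  have hk := integrable_cutoffKernel hN
  set G : ℕ → ℝ → ℂ := fun n t => LSeries.term a s n * ((cutoffKernel N t : ℂ) *
    Complex.exp (2 * Real.pi * t * Real.log n * Complex.I)) with hG
  have hint : ∀ n, Integrable (G n) := by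
    intro n
    refine Integrable.const_mul ?_ _
    refine hk.ofReal.mul_bdd (c := 1) ?_ (Eventually.of_forall fun t => (hexp t n).le)
    exact (by fun_prop : Continuous fun t : ℝ =>
      Complex.exp (2 * Real.pi * t * Real.log n * Complex.I)).aestronglyMeasurable
  have hnorm : ∀ n, ∫ t, ‖G n t‖ = ‖LSeries.term a s n‖ * ∫ t, |cutoffKernel N t| := by
    intro n
    rw [← integral_const_mul]
    congr 1
    funext t
    rw [hG]
    simp only [norm_mul, hexp, mul_one, Complex.norm_real, Real.norm_eq_abs]
  have hsummable : Summable fun n => ∫ t, ‖G n t‖ := by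
    simp_rw [hnorm]
    exact (hsum s hs).summable.norm.mul_right _
  have h1 := hasSum_integral_of_summable_integral_norm hint hsummable
  have h2 : ∀ t, ∑' n, G n t = (cutoffKernel N t : ℂ) * F (s - 2 * Real.pi * t * Complex.I) := by
    intro t
    have hs' : s - 2 * Real.pi * t * Complex.I ∈ halfPlane σ := by
      change σ < _
      rw [sub_vertical_re]
      exact hs
    have h3 : HasSum _ _ := (hsum _ hs')
    refine (HasSum.congr_fun (h3.mul_left (cutoffKernel N t : ℂ)) ?_).tsum_eq
    intro n
    rw [term_sub_vertical, hG]
    ring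
  simp_rw [h2] at h1
  refine h1.unique ?_
  -- Integrated against the kernel, the frequency `log n` survives exactly when `n ≤ N`; the term at
  -- `n = 0` vanishes by convention.
  have h4 : ∀ n, ∫ t, G n t = if n ∈ Finset.Icc 1 N then LSeries.term a s n else 0 := by
    intro n
    rw [hG]
    simp only [integral_const_mul]
    rcases Nat.eq_zero_or_pos n with rfl | hn
    · simp
    · rw [integral_cutoffKernel hN hn]
      by_cases hle : n ≤ N
      · simp [hle, Finset.mem_Icc, Nat.one_le_iff_ne_zero.1 hn]
      · simp [hle, Finset.mem_Icc]
  simp_rw [h4]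
  rw [partialSum_eq_sum_term]
  have h5 := hasSum_sum_of_ne_finset_zero (f := fun n =>
    if n ∈ Finset.Icc 1 N then LSeries.term a s n else 0) (s := Finset.Icc 1 N)
    (L := .unconditional ℕ) fun n hn => if_neg hn
  rwa [Finset.sum_congr rfl fun n hn => if_pos hn] at h5

/-- The convolution formula is known only where the series converges absolutely. Both sides are
analytic on `Re s > ε`, so the identity theorem extends it there, and the convolution is trivially
bounded. -/
lemma norm_partialSum_le_integral {a : ArithmeticFunction ℂ} {F : ℂ → ℂ} {ε σ M : ℝ}
    (hF : DifferentiableOn ℂ F (halfPlane ε)) (hM : ∀ s ∈ halfPlane ε, ‖F s‖ ≤ M)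
    (hsum : ∀ s ∈ halfPlane σ, LSeriesHasSum a s (F s)) {N : ℕ} (hN : 1 ≤ N) {s : ℂ}
    (hs : s ∈ halfPlane ε) :
    ‖partialSum a s N‖ ≤ (∫ t, |cutoffKernel N t|) * M := by
  have hk := integrable_cutoffKernel hN
  set z₀ : ℂ := ((max ε σ + 1 : ℝ) : ℂ) with hz₀
  have hzε : z₀ ∈ halfPlane ε := by
    change ε < z₀.re
    rw [hz₀, Complex.ofReal_re]
    linarith [le_max_left ε σ]
  have hzσ : z₀ ∈ halfPlane σ := by
    change σ < z₀.re
    rw [hz₀, Complex.ofReal_re]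
    linarith [le_max_right ε σ]
  have heq := ((differentiableOn_integral_vertical hF hM hk).analyticOnNhd
    (isOpen_halfPlane ε)).eqOn_of_preconnected_of_eventuallyEq
    ((differentiable_partialSum a N).differentiableOn.analyticOnNhd (isOpen_halfPlane ε))
    (isPreconnected_halfPlane ε) hzε (by
      filter_upwards [(isOpen_halfPlane σ).mem_nhds hzσ] with z hz
      exact integral_cutoffKernel_mul hsum hN hz)
  have h := norm_integral_vertical_le hM hk hs
  have h' := heq hs
  simp only at h'
  rwa [h'] at h

/-! ### Partial summation and Bohr's theorem -/

lemma sum_Icc_mul_by_parts (c w : ℕ → ℂ) (N : ℕ) :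
    ∑ n ∈ Finset.Icc 1 N, c n * w n = (∑ n ∈ Finset.Icc 1 N, c n) * w N +
      ∑ n ∈ Finset.range N, (∑ m ∈ Finset.Icc 1 n, c m) * (w n - w (n + 1)) := by
  induction N with
  | zero => simp
  | succ N ih =>
    rw [Finset.sum_Icc_succ_top (by omega), Finset.sum_Icc_succ_top (by omega),
      Finset.sum_range_succ, ih]
    ring

/-- Follows from `(1 + 1 / n) ^ (-δ) ≥ 1 - δ / n`, which combines `exp x ≥ 1 + x` with `log (1 + 1 /
n) ≤ 1 / n`. -/
lemma rpow_neg_sub_rpow_neg_le {δ : ℝ} (hδ : 0 ≤ δ) {n : ℕ} (hn : 1 ≤ n) :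
    |(n : ℝ) ^ (-δ) - ((n + 1 : ℕ) : ℝ) ^ (-δ)| ≤ δ * (n : ℝ) ^ (-δ - 1) := by
  have hn0 : (0 : ℝ) < n := by exact_mod_cast hn
  have hanti : ((n + 1 : ℕ) : ℝ) ^ (-δ) ≤ (n : ℝ) ^ (-δ) :=
    Real.rpow_le_rpow_of_nonpos hn0 (by push_cast; linarith) (by linarith)
  rw [abs_of_nonneg (sub_nonneg.2 hanti)]
  have h1 : ((n + 1 : ℕ) : ℝ) ^ (-δ) = (n : ℝ) ^ (-δ) * (1 + 1 / (n : ℝ)) ^ (-δ) := by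
    rw [← Real.mul_rpow hn0.le (by positivity)]
    congr 1
    push_cast
    field_simp
  have h2 : 1 - δ / n ≤ (1 + 1 / (n : ℝ)) ^ (-δ) := by
    rw [Real.rpow_def_of_pos (by positivity)]
    have h3 := Real.log_le_sub_one_of_pos (show (0 : ℝ) < 1 + 1 / n by positivity)
    have h4 := Real.add_one_le_exp (Real.log (1 + 1 / (n : ℝ)) * -δ)
    have h5 : Real.log (1 + 1 / (n : ℝ)) * δ ≤ 1 / n * δ :=
      mul_le_mul_of_nonneg_right (by linarith) hδ
    have h6 : 1 / (n : ℝ) * δ = δ / n := by ring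
    linarith
  have h7 : δ * (n : ℝ) ^ (-δ - 1) = (n : ℝ) ^ (-δ) * (δ / n) := by
    rw [Real.rpow_sub_one hn0.ne']
    ring
  have h8 : 0 ≤ (n : ℝ) ^ (-δ) := by positivity
  rw [h1, h7]
  nlinarith [mul_le_mul_of_nonneg_left h2 h8]

lemma partialSum_by_parts (a : ArithmeticFunction ℂ) (s : ℂ) (δ : ℝ) (N : ℕ) :
    partialSum a s N = partialSum a (s - δ) N * ((N : ℝ) ^ (-δ) : ℝ) +
      ∑ n ∈ Finset.range N, partialSum a (s - δ) n *
        (((n : ℝ) ^ (-δ) - ((n + 1 : ℕ) : ℝ) ^ (-δ) : ℝ) : ℂ) := by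
  have h := sum_Icc_mul_by_parts (fun n => a n * (n : ℂ) ^ (-(s - δ)))
    (fun n => (((n : ℝ) ^ (-δ) : ℝ) : ℂ)) N
  simp only [← Complex.ofReal_sub] at h
  rw [partialSum, partialSum]
  simp only [partialSum]
  rw [← h]
  refine Finset.sum_congr rfl fun n hn => ?_
  have hn0 : (n : ℂ) ≠ 0 := by
    have := (Finset.mem_Icc.1 hn).1
    exact_mod_cast (by omega : n ≠ 0)
  rw [mul_assoc, Complex.ofReal_cpow (by positivity), Complex.ofReal_natCast,
    ← Complex.cpow_add _ _ hn0]
  congr 2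
  push_cast
  ring

/-- Partial summation: if the partial sums grow at most like `n ^ θ` on a half-plane, then the
series converges uniformly on the half-plane shifted by `δ > θ`, with bounded partial sums. -/
lemma exists_bound_tendstoUniformlyOn {θ δ : ℝ} (hθ : 0 ≤ θ) (hδ : θ < δ) :
    ∃ L : ℝ, 0 ≤ L ∧ ∀ (a : ArithmeticFunction ℂ) (ε C : ℝ),
      (∀ s ∈ halfPlane ε, ∀ n : ℕ, 1 ≤ n → ‖partialSum a s n‖ ≤ C * (n : ℝ) ^ θ) →
      (∀ s ∈ halfPlane (ε + δ), ∀ n : ℕ, ‖partialSum a s n‖ ≤ C * L) ∧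
      ∃ G : ℂ → ℂ, TendstoUniformlyOn (fun N s => partialSum a s N) G atTop
        (halfPlane (ε + δ)) := by
  have hδ0 : 0 < δ := hθ.trans_lt hδ
  set u : ℕ → ℝ := fun n => δ * (n : ℝ) ^ (θ - δ - 1) with hu
  have hu0 : ∀ n, 0 ≤ u n := fun n => by positivity
  have husum : Summable u := (Real.summable_nat_rpow.2 (by linarith)).mul_left δ
  -- The `1` pays for the boundary term and the series for the differences of weights. Neither
  -- depends on `a`, `ε` or `C`.
  refine ⟨1 + ∑' n, u n, add_nonneg zero_le_one (tsum_nonneg hu0), fun a ε C ha => ?_⟩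
  have hmem : ∀ s ∈ halfPlane (ε + δ), s - δ ∈ halfPlane ε := by
    intro s hs
    change ε < (s - δ).re
    have : ε + δ < s.re := hs
    simp
    linarith
  have hC : 0 ≤ C := by
    have h := (norm_nonneg _).trans (ha ((ε + 1 : ℝ) : ℂ) (by
      change ε < Complex.re _
      rw [Complex.ofReal_re]
      linarith) 1 le_rfl)
    simpa using h
  have hmain : ∀ s ∈ halfPlane (ε + δ), ∀ n : ℕ, 1 ≤ n →
      ‖partialSum a (s - δ) n * ((n : ℝ) ^ (-δ) : ℝ)‖ ≤ C * (n : ℝ) ^ (-(δ - θ)) := by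
    intro s hs n hn
    have hn0 : (0 : ℝ) < n := by exact_mod_cast hn
    rw [norm_mul, Complex.norm_real, Real.norm_of_nonneg (by positivity)]
    calc _ ≤ C * (n : ℝ) ^ θ * (n : ℝ) ^ (-δ) := by
          gcongr
          exact ha _ (hmem s hs) n hn
      _ = _ := by
          rw [mul_assoc, ← Real.rpow_add hn0]
          congr 2
          ring
  have hterm : ∀ n : ℕ, ∀ s ∈ halfPlane (ε + δ), ‖partialSum a (s - δ) n *
      (((n : ℝ) ^ (-δ) - ((n + 1 : ℕ) : ℝ) ^ (-δ) : ℝ) : ℂ)‖ ≤ C * u n := by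
    intro n s hs
    rcases Nat.eq_zero_or_pos n with rfl | hn
    · have : partialSum a (s - δ) 0 = 0 := by simp [partialSum]
      rw [this, zero_mul, norm_zero]
      exact mul_nonneg hC (hu0 0)
    · have hn0 : (0 : ℝ) < n := by exact_mod_cast hn
      rw [norm_mul, Complex.norm_real, Real.norm_eq_abs]
      calc _ ≤ C * (n : ℝ) ^ θ * (δ * (n : ℝ) ^ (-δ - 1)) :=
            mul_le_mul (ha _ (hmem s hs) n hn) (rpow_neg_sub_rpow_neg_le hδ0.le hn)
              (abs_nonneg _) (by positivity)
        _ = C * (δ * ((n : ℝ) ^ θ * (n : ℝ) ^ (-δ - 1))) := by ring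
        _ = C * u n := by
            rw [← Real.rpow_add hn0, hu]
            congr 3
            ring
  constructor
  · intro s hs N
    rcases Nat.eq_zero_or_pos N with rfl | hN
    · have : partialSum a s 0 = 0 := by simp [partialSum]
      rw [this, norm_zero]
      exact mul_nonneg hC (add_nonneg zero_le_one (tsum_nonneg hu0))
    · rw [partialSum_by_parts a s δ N, mul_add]
      refine (norm_add_le _ _).trans (add_le_add ?_ ?_)
      · refine (hmain s hs N hN).trans (mul_le_mul_of_nonneg_left ?_ hC)
        exact Real.rpow_le_one_of_one_le_of_nonpos (by exact_mod_cast hN) (by linarith)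
      · refine (norm_sum_le_of_le _ fun n _ => hterm n s hs).trans ?_
        rw [← Finset.mul_sum]
        exact mul_le_mul_of_nonneg_left (husum.sum_le_tsum _ fun n _ => hu0 n) hC
  · have h1 := tendstoUniformlyOn_tsum_nat (husum.mul_left C) hterm
    have h2 : TendstoUniformlyOn
        (fun (N : ℕ) (s : ℂ) => partialSum a (s - δ) N * ((N : ℝ) ^ (-δ) : ℝ)) (fun _ => 0) atTop
        (halfPlane (ε + δ)) := by
      rw [Metric.tendstoUniformlyOn_iff]
      intro η hη
      have h3 : Tendsto (fun n : ℕ => C * (n : ℝ) ^ (-(δ - θ))) atTop (𝓝 (C * 0)) :=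
        ((tendsto_rpow_neg_atTop (by linarith)).comp tendsto_natCast_atTop_atTop).const_mul C
      rw [mul_zero] at h3
      filter_upwards [h3.eventually (gt_mem_nhds hη), eventually_ge_atTop 1] with N hN hN1 s hs
      rw [dist_zero_left]
      exact (hmain s hs N hN1).trans_lt hN
    refine ⟨_, (h2.add h1).congr (Eventually.of_forall fun N s _ => ?_)⟩
    exact (partialSum_by_parts a s δ N).symm

/-- A quantitative form of Bohr's theorem: the partial sums are bounded by the supremum of the
function on a slightly larger half-plane. -/
theorem exists_norm_partialSum_le {δ : ℝ} (hδ : 0 < δ) :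
    ∃ L : ℝ, 0 ≤ L ∧ ∀ (a : ArithmeticFunction ℂ) (F : ℂ → ℂ) (ε σ M : ℝ),
      DifferentiableOn ℂ F (halfPlane ε) → (∀ s ∈ halfPlane ε, ‖F s‖ ≤ M) →
      (∀ s ∈ halfPlane σ, LSeriesHasSum a s (F s)) →
      ∀ s ∈ halfPlane (ε + δ), ∀ N : ℕ, ‖partialSum a s N‖ ≤ L * M := by
  -- Below `δ` for the partial summation, at most `1` for the kernel bound.
  set θ := min (δ / 2) 1 with hθ
  have hθ0 : 0 < θ := lt_min (half_pos hδ) one_pos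
  have hθδ : θ < δ := (min_le_left _ _).trans_lt (half_lt_self hδ)
  obtain ⟨K, hK0, hK⟩ := exists_integral_abs_cutoffKernel_le hθ0 (min_le_right _ _)
  obtain ⟨L, hL0, hL⟩ := exists_bound_tendstoUniformlyOn hθ0.le hθδ
  refine ⟨K * L, mul_nonneg hK0 hL0, fun a F ε σ M hF hM hsum s hs N => ?_⟩
  have hM0 : 0 ≤ M := by
    obtain ⟨z, hz⟩ := halfPlane_nonempty ε
    exact (norm_nonneg _).trans (hM z hz)
  have h := (hL a ε (K * M) fun z hz n hn => ?_).1 s hs N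
  · rwa [mul_right_comm] at h
  · refine (norm_partialSum_le_integral hF hM hsum hn hz).trans ?_
    rw [mul_right_comm]
    exact mul_le_mul_of_nonneg_right (hK n hn) hM0

/-! ### Membership from bounded partial sums -/

section BoundedPartialSums

variable {a : ArithmeticFunction ℂ}

/-- Partial summation with growth exponent `0`, at the cost of a shift by `ε / 2`. -/
lemma tendstoUniformlyOn_of_bounded
    (ha : ∀ ε : ℝ, 0 < ε → ∃ C : ℝ, ∀ s ∈ halfPlane ε, ∀ N : ℕ, ‖partialSum a s N‖ ≤ C)
    {ε : ℝ} (hε : 0 < ε) :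
    TendstoUniformlyOn (fun N s => partialSum a s N) (value a) atTop (halfPlane ε) := by
  obtain ⟨C, hC⟩ := ha (ε / 2) (half_pos hε)
  obtain ⟨L, -, hL⟩ := exists_bound_tendstoUniformlyOn le_rfl (half_pos hε)
  obtain ⟨-, G, hG⟩ := hL a (ε / 2) C fun s hs n _ => by simpa using hC s hs n
  rw [add_halves] at hG
  exact hG.congr_right fun s hs => ((hG.tendsto_at hs).limUnder_eq).symm

lemma tendstoLocallyUniformlyOn_of_bounded
    (ha : ∀ ε : ℝ, 0 < ε → ∃ C : ℝ, ∀ s ∈ halfPlane ε, ∀ N : ℕ, ‖partialSum a s N‖ ≤ C) :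
    TendstoLocallyUniformlyOn (fun N s => partialSum a s N) (value a) atTop (halfPlane 0) := by
  refine tendstoLocallyUniformlyOn_of_forall_exists_nhds fun s hs => ?_
  have hs0 : 0 < s.re := hs
  refine ⟨halfPlane (s.re / 2), mem_nhdsWithin_of_mem_nhds
    ((isOpen_halfPlane _).mem_nhds (half_lt_self hs0)),
    tendstoUniformlyOn_of_bounded ha (half_pos hs0)⟩

/-- Weierstrass' theorem gives analyticity of the locally uniform limit, and the bounds pass to the
limit. -/
lemma mem_HInfPlus_of_bounded
    (ha : ∀ ε : ℝ, 0 < ε → ∃ C : ℝ, ∀ s ∈ halfPlane ε, ∀ N : ℕ, ‖partialSum a s N‖ ≤ C) :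
    a ∈ HInfPlus := by
  have hlu := tendstoLocallyUniformlyOn_of_bounded ha
  refine ⟨fun s hs => ⟨_, hlu.tendsto_at hs⟩, ?_, fun ε hε => ?_⟩
  · exact hlu.differentiableOn
      (Eventually.of_forall fun N => (differentiable_partialSum a N).differentiableOn)
      (isOpen_halfPlane 0)
  · obtain ⟨C, hC⟩ := ha ε hε
    exact ⟨C, fun s hs => le_of_tendsto ((hlu.tendsto_at (lt_trans hε hs)).norm)
      (Eventually.of_forall fun N => hC s hs N)⟩

end BoundedPartialSums

lemma halfPlane_subset {r r' : ℝ} (h : r ≤ r') : halfPlane r' ⊆ halfPlane r :=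
  fun _ hs => lt_of_le_of_lt h hs

/-- Convergence at `s = 1` bounds the terms there, so `a n = O(n)` and the series converges
absolutely for `Re s > 2`. -/
lemma LSeriesHasSum_value {a : ArithmeticFunction ℂ} (ha : ∀ s ∈ halfPlane 0, ConvergesAt a s)
    {s : ℂ} (hs : s ∈ halfPlane 2) : LSeriesHasSum a s (value a s) := by
  have hsummable : LSeriesSummable a s := by
    refine LSeriesSummable_of_le_const_mul_rpow (x := 2) hs ?_
    obtain ⟨l, hl⟩ := ha 1 (by simp [halfPlane])
    obtain ⟨C, hC⟩ := hl.norm.bddAbove_range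
    refine ⟨2 * C, fun n hn => ?_⟩
    obtain ⟨m, rfl⟩ := Nat.exists_eq_succ_of_ne_zero hn
    have h1 : a (m + 1) * ((m + 1 : ℕ) : ℂ) ^ (-1 : ℂ) =
        partialSum a 1 (m + 1) - partialSum a 1 m := by
      rw [partialSum, partialSum, Finset.sum_Icc_succ_top (by omega)]
      ring
    have h2 : ‖a (m + 1) * ((m + 1 : ℕ) : ℂ) ^ (-1 : ℂ)‖ ≤ 2 * C := by
      rw [h1, two_mul]
      exact (norm_sub_le _ _).trans (add_le_add (hC ⟨m + 1, rfl⟩) (hC ⟨m, rfl⟩))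
    rw [Complex.cpow_neg_one, norm_mul, norm_inv, Complex.norm_natCast, ← div_eq_mul_inv,
      div_le_iff₀ (by positivity)] at h2
    rw [show (2 - 1 : ℝ) = 1 by norm_num, Real.rpow_one]
    exact h2
  have h := hsummable.hasSum
  have h1 := h.tendsto_sum_nat.comp (tendsto_add_atTop_nat 1)
  have h2 : (fun N => ∑ i ∈ Finset.range N, LSeries.term a s i) ∘ (fun N => N + 1) =
      partialSum a s := by
    funext N
    rw [partialSum_eq_sum_term, Function.comp_apply, Finset.sum_range_succ', LSeries.term_zero,
      add_zero, Finset.range_eq_Ico, Finset.sum_Ico_add' (fun i => LSeries.term a s i) 0 N 1]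
    rfl
  rw [h2] at h1
  have h3 : value a s = _ := h1.limUnder_eq
  rw [LSeriesHasSum, h3]
  exact h

/-! ### Derivatives and products -/

namespace HInfPlus

lemma exists_norm_partialSum_le {f : ArithmeticFunction ℂ} (hf : f ∈ HInfPlus) (ε : ℝ)
    (hε : 0 < ε) : ∃ C : ℝ, ∀ s ∈ halfPlane ε, ∀ N : ℕ, ‖partialSum f s N‖ ≤ C := by
  obtain ⟨L, -, hL⟩ := DirichletSpace.exists_norm_partialSum_le (half_pos hε)
  obtain ⟨M, hM⟩ := hf.2.2 (ε / 2) (half_pos hε)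
  refine ⟨L * M, fun s hs N => ?_⟩
  exact hL f (value f) (ε / 2) 2 M (hf.2.1.mono (halfPlane_subset (half_pos hε).le)) hM
    (fun z hz => LSeriesHasSum_value hf.1 hz) s (by rwa [add_halves]) N

/-- Locally uniform convergence passes to derivatives, which identifies the sum of `D g` with the
derivative of the sum of `g`; Cauchy's estimate bounds it. -/
lemma D_mem {g : ArithmeticFunction ℂ} (hg : g ∈ HInfPlus) : D g ∈ HInfPlus := by
  have hlu := (tendstoLocallyUniformlyOn_of_bounded (exists_norm_partialSum_le hg)).deriv
    (Eventually.of_forall fun N => (differentiable_partialSum g N).differentiableOn)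
    (isOpen_halfPlane 0)
  have hlim : ∀ s ∈ halfPlane 0, Tendsto (partialSum (D g) s) atTop (𝓝 (deriv (value g) s)) := by
    intro s hs
    refine (hlu.tendsto_at hs).congr fun N => ?_
    exact (hasDerivAt_partialSum g N s).deriv
  have hval : ∀ s ∈ halfPlane 0, value (D g) s = deriv (value g) s := fun s hs =>
    (hlim s hs).limUnder_eq
  refine ⟨fun s hs => ⟨_, hlim s hs⟩, ?_, fun ε hε => ?_⟩
  · exact (hg.2.1.deriv (isOpen_halfPlane 0)).congr hval
  · obtain ⟨M, hM⟩ := hg.2.2 (ε / 2) (half_pos hε)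
    refine ⟨M / (ε / 2), fun s hs => ?_⟩
    rw [hval s (lt_trans hε hs)]
    refine norm_deriv_le_of_bounded (hg.2.1.mono (halfPlane_subset (half_pos hε).le)) hM
      (half_pos hε) ?_
    rw [add_halves]
    exact hs

/-- The partial sums of a product are controlled by the suprema of the factors. -/
lemma exists_norm_partialSum_mul_le {ε : ℝ} (hε : 0 < ε) :
    ∃ L : ℝ, 0 ≤ L ∧ ∀ f ∈ HInfPlus, ∀ h ∈ HInfPlus, ∀ M₁ M₂ : ℝ,
      (∀ s ∈ halfPlane (ε / 2), ‖value f s‖ ≤ M₁) → (∀ s ∈ halfPlane (ε / 2), ‖value h s‖ ≤ M₂) →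
      ∀ s ∈ halfPlane ε, ∀ N : ℕ, ‖partialSum (f * h) s N‖ ≤ L * (M₁ * M₂) := by
  obtain ⟨L, hL0, hL⟩ := DirichletSpace.exists_norm_partialSum_le (half_pos hε)
  refine ⟨L, hL0, fun f hf h hh M₁ M₂ h₁ h₂ s hs N => ?_⟩
  -- The product series need only represent the product function on `Re s > 2`; control further left
  -- comes from Bohr's theorem.
  refine hL (f * h) (fun z => value f z * value h z) (ε / 2) 2 (M₁ * M₂)
    ((hf.2.1.mul hh.2.1).mono (halfPlane_subset (half_pos hε).le)) (fun z hz => ?_)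
    (fun z hz => ?_) s (by rwa [add_halves]) N
  · rw [norm_mul]
    exact mul_le_mul (h₁ z hz) (h₂ z hz) (norm_nonneg _) ((norm_nonneg _).trans (h₁ z hz))
  · exact ArithmeticFunction.LSeriesHasSum_mul (LSeriesHasSum_value hf.1 hz)
      (LSeriesHasSum_value hh.1 hz)

end HInfPlus

/-! ### The Volterra operator -/

/-- Summation by parts against positive decreasing weights: the differences telescope and leave `K`
times the first weight, `1 / log 2`. -/
lemma norm_partialSum_J_le {b : ArithmeticFunction ℂ} (hb : b 1 = 0) {s : ℂ} {K : ℝ}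
    (hK : ∀ N, ‖partialSum b s N‖ ≤ K) (N : ℕ) :
    ‖partialSum (J b) s N‖ ≤ K / Real.log 2 := by
  -- Replacing `n` by `max n 2` keeps the weights positive and decreasing from `n = 0` on; the value
  -- at `n = 1` is irrelevant because `b 1 = 0`.
  set w : ℕ → ℝ := fun n => (Real.log (max n 2 : ℕ))⁻¹ with hw
  have hlog : ∀ n : ℕ, 0 < Real.log (max n 2 : ℕ) := fun n =>
    Real.log_pos (by exact_mod_cast (le_max_right n 2))
  have hw0 : ∀ n, 0 ≤ w n := fun n => (inv_pos.2 (hlog n)).le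
  have hanti : ∀ n, w (n + 1) ≤ w n := fun n =>
    inv_anti₀ (hlog n) (Real.log_le_log (by positivity)
      (by exact_mod_cast max_le_max_right 2 (Nat.le_succ n)))
  have h1 : partialSum (J b) s N =
      -∑ n ∈ Finset.Icc 1 N, (b n * (n : ℂ) ^ (-s)) * (w n : ℂ) := by
    rw [partialSum, ← Finset.sum_neg_distrib]
    refine Finset.sum_congr rfl fun n hn => ?_
    change (if 2 ≤ n then -(b n / (Real.log n : ℂ)) else 0) * _ = _
    split_ifs with h2
    · rw [hw]
      simp only [max_eq_left h2]
      push_cast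
      ring
    · have : n = 1 := by
        have := (Finset.mem_Icc.1 hn).1
        omega
      rw [this, hb]
      simp
  rw [h1, norm_neg, sum_Icc_mul_by_parts]
  refine (norm_add_le _ _).trans ?_
  have h2 : ‖(∑ n ∈ Finset.Icc 1 N, b n * (n : ℂ) ^ (-s)) * (w N : ℂ)‖ ≤ K * w N := by
    rw [norm_mul, Complex.norm_real, Real.norm_of_nonneg (hw0 N)]
    exact mul_le_mul_of_nonneg_right (hK N) (hw0 N)
  have h3 : ‖∑ n ∈ Finset.range N, (∑ m ∈ Finset.Icc 1 n, b m * (m : ℂ) ^ (-s)) *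
      ((w n : ℂ) - w (n + 1))‖ ≤ ∑ n ∈ Finset.range N, K * (w n - w (n + 1)) := by
    refine norm_sum_le_of_le _ fun n _ => ?_
    rw [norm_mul, ← Complex.ofReal_sub, Complex.norm_real,
      Real.norm_of_nonneg (sub_nonneg.2 (hanti n))]
    exact mul_le_mul_of_nonneg_right (hK n) (sub_nonneg.2 (hanti n))
  refine (add_le_add h2 h3).trans (le_of_eq ?_)
  rw [← Finset.mul_sum, Finset.sum_range_sub', ← mul_add]
  simp [hw, div_eq_mul_inv]

/-- The partial sums of `V_g f` are controlled by the suprema of `g'` and `f`. -/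
lemma exists_norm_partialSum_volterra_le {ε : ℝ} (hε : 0 < ε) :
    ∃ L : ℝ, 0 ≤ L ∧ ∀ g ∈ HInfPlus, ∀ f ∈ HInfPlus, ∀ M₁ M₂ : ℝ,
      (∀ s ∈ halfPlane (ε / 2), ‖value (D g) s‖ ≤ M₁) →
      (∀ s ∈ halfPlane (ε / 2), ‖value f s‖ ≤ M₂) →
      ∀ s ∈ halfPlane ε, ∀ N : ℕ, ‖partialSum (volterra g f) s N‖ ≤ L * (M₁ * M₂) := by
  obtain ⟨L, hL0, hL⟩ := HInfPlus.exists_norm_partialSum_mul_le hε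
  have h2 : 0 < Real.log 2 := Real.log_pos one_lt_two
  refine ⟨L / Real.log 2, div_nonneg hL0 h2.le, fun g hg f hf M₁ M₂ h₁ h₂ s hs N => ?_⟩
  rw [div_mul_eq_mul_div]
  exact norm_partialSum_J_le (D_mul_apply_one g f)
    (hL _ (HInfPlus.D_mem hg) f hf M₁ M₂ h₁ h₂ s hs) N

lemma volterra_mem {g f : ArithmeticFunction ℂ} (hg : g ∈ HInfPlus) (hf : f ∈ HInfPlus) :
    volterra g f ∈ HInfPlus := by
  refine mem_HInfPlus_of_bounded fun ε hε => ?_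
  obtain ⟨L, -, hL⟩ := exists_norm_partialSum_volterra_le hε
  obtain ⟨M₁, h₁⟩ := (HInfPlus.D_mem hg).2.2 (ε / 2) (half_pos hε)
  obtain ⟨M₂, h₂⟩ := hf.2.2 (ε / 2) (half_pos hε)
  exact ⟨_, hL g hg f hf M₁ M₂ h₁ h₂⟩

lemma one_mem_HInfPlus : (1 : ArithmeticFunction ℂ) ∈ HInfPlus := by
  refine mem_HInfPlus_of_bounded fun ε _ => ⟨1, fun s _ N => ?_⟩
  rcases Nat.eq_zero_or_pos N with rfl | hN
  · simp [partialSum]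
  · rw [partialSum, Finset.sum_eq_single_of_mem 1 (Finset.mem_Icc.2 ⟨le_rfl, hN⟩)]
    · simp
    · intro n _ hn
      rw [ArithmeticFunction.one_apply_ne hn, zero_mul]

lemma volterra_one (g : ArithmeticFunction ℂ) : volterra g 1 = g - g 1 • 1 := by
  change J (D g * 1) = _
  rw [mul_one]
  ext n
  change (if 2 ≤ n then -(-(g n * (Real.log n : ℂ)) / (Real.log n : ℂ)) else 0) =
    g n - g 1 * (1 : ArithmeticFunction ℂ) n
  split_ifs with hn
  · have hlog : (Real.log n : ℂ) ≠ 0 := by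
      exact_mod_cast (Real.log_pos (by exact_mod_cast hn)).ne'
    rw [ArithmeticFunction.one_apply_ne (by omega)]
    field_simp
    ring
  · interval_cases n <;> simp

lemma mem_of_volterra_mem {g : ArithmeticFunction ℂ}
    (h : ∀ f ∈ HInfPlus, volterra g f ∈ HInfPlus) : g ∈ HInfPlus := by
  have h1 := h 1 one_mem_HInfPlus
  rw [volterra_one] at h1
  simpa using add_mem h1 (HInfPlus.smul_mem (g 1) one_mem_HInfPlus)

/-! ### Continuity -/

lemma withSeminorms_supSeminorm : WithSeminorms supSeminorm := ⟨rfl⟩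

lemma norm_value_le_supSeminorm (f : HInfPlus) (ε : {ε : ℝ // 0 < ε}) {s : ℂ}
    (hs : s ∈ halfPlane ε) : ‖value f.1 s‖ ≤ supSeminorm ε f :=
  le_ciSup (HInfPlus.bddAbove f ε.2) ⟨s, hs⟩

/-- Since `L` does not depend on `f`, the seminorm at `ε` of the image is at most `L * M₁` times the
seminorm of `f` at `ε / 2`, with `M₁` a bound for `g'`. -/
lemma continuous_volterra_restrict {g : ArithmeticFunction ℂ}
    (h : ∀ f ∈ HInfPlus, volterra g f ∈ HInfPlus) : Continuous ((volterra g).restrict h) := by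
  have hg := mem_of_volterra_mem h
  refine WithSeminorms.continuous_of_isBounded withSeminorms_supSeminorm withSeminorms_supSeminorm _
    (Seminorm.IsBounded.of_real fun ε => ?_)
  obtain ⟨L, hL0, hL⟩ := exists_norm_partialSum_volterra_le ε.2
  obtain ⟨M₁, h₁⟩ := (HInfPlus.D_mem hg).2.2 (ε / 2) (half_pos ε.2)
  refine ⟨{⟨ε / 2, half_pos ε.2⟩}, L * M₁, fun f => ?_⟩
  rw [Finset.sup_singleton]
  have := halfPlane_nonempty ε
  refine ciSup_le fun s => ?_
  refine le_of_tendsto (HInfPlus.convergesAt _ ε.2 s).tendsto.norm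
    (Eventually.of_forall fun N => ?_)
  rw [mul_assoc]
  exact hL g hg f.1 f.2 M₁ _ h₁
    (fun z hz => norm_value_le_supSeminorm f ⟨ε / 2, half_pos ε.2⟩ hz) s s.2 N

end DirichletSpace

end

theorem corollary1 (g : ArithmeticFunction ℂ) (hg : DirichletSpace.abscissaOfConv g ≤ 0) :
    ((∀ f ∈ DirichletSpace.HInfPlus, DirichletSpace.volterra g f ∈ DirichletSpace.HInfPlus) ↔
      g ∈ DirichletSpace.HInfPlus) ∧
    ∀ h : ∀ f ∈ DirichletSpace.HInfPlus,
        DirichletSpace.volterra g f ∈ DirichletSpace.HInfPlus,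
      Continuous ((DirichletSpace.volterra g).restrict h) :=
  ⟨⟨DirichletSpace.mem_of_volterra_mem, fun hg' _ hf => DirichletSpace.volterra_mem hg' hf⟩,
    fun h => DirichletSpace.continuous_volterra_restrict h⟩
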